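/- Consider oriented links in $S^3$, up to ambient isotopy, whose components may carry labels (in particular ordered links, or links without labels); all isotopies and moves respect orientations and labels. In a diagram, consider a disk in which two parallel strands (the first pair) cross over two other parallel strands (the second pair), so that the disk contains exactly four crossings, and consider the local move which makes the first pair pass under the second pair, that is, which changes these four crossings, as well as the inverse of this move. The four strands may belong to any components of the link. The move is a \emph{pass-move} if in each of the two pairs the two strands have opposite orientations, and it is a \emph{$p\#$-move} if the two strands have opposite orientations in one of the pairs and the same orientation in the other pair. The equivalence relation on links generated by the $p\#$-move coincides with the one generated by the pass-move (pass-equivalence). More precisely, if two links are related by a single $p\#$-move, then they are related by a sequence of two pass-moves, and if two links are related by a single pass-move, then they are related by a sequence of two $p\#$-moves. -/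

import Mathlib

/-!
Oriented links in the `3`-sphere (equivalently in `ℝ³`), given as link diagrams modulo planar
isotopy and the Reidemeister moves, and local moves on them.

A plane diagram in general position with respect to the height function is cut by horizontal
lines into slices, each of which consists of vertical strands and exactly one elementary piece:
a crossing, a local minimum or a local maximum. A diagram is therefore a word in such slices,
read from bottom to top.
-/

namespace LinkDiagram

universe u

/-- A strand meeting a horizontal line: its orientation there (`true`: upwards, `false`:
downwards), and the label of the link component to which it belongs. -/
structure Strand (ι : Type u) where
  up : Bool
  comp : ι

/-- The strand of the same component that runs in the opposite vertical direction. -/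
def Strand.flip {ι : Type u} (s : Strand ι) : Strand ι := ⟨!s.up, s.comp⟩

/-- The elementary pieces of a diagram. Orientations and labels are propagated along the strands.
* `cup s`: a local minimum, whose left leg is `s`;
* `cap s`: a local maximum, whose left leg is `s`;
* `cross o s t`: the strands `s` (bottom left to top right) and `t` (bottom right to top left)
  cross; `s` passes over `t` if `o = true`, and `s` passes under `t` if `o = false`. -/
inductive Piece (ι : Type u) : Type u
  | cup (s : Strand ι)
  | cap (s : Strand ι)
  | cross (o : Bool) (s t : Strand ι)

/-- The strands at the bottom of a piece, from left to right. -/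
def Piece.bot {ι : Type u} : Piece ι → List (Strand ι)
  | .cup _ => []
  | .cap s => [s, s.flip]
  | .cross _ s t => [s, t]

/-- The strands at the top of a piece, from left to right. -/
def Piece.top {ι : Type u} : Piece ι → List (Strand ι)
  | .cup s => [s, s.flip]
  | .cap _ => []
  | .cross _ s t => [t, s]

/-- A slice: one elementary piece, with vertical strands on its left and on its right. -/
structure Slice (ι : Type u) where
  left : List (Strand ι)
  piece : Piece ι
  right : List (Strand ι)

/-- The strands at the bottom of a slice. -/
def Slice.bot {ι : Type u} (e : Slice ι) : List (Strand ι) := e.left ++ e.piece.bot ++ e.right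

/-- The strands at the top of a slice. -/
def Slice.top {ι : Type u} (e : Slice ι) : List (Strand ι) := e.left ++ e.piece.top ++ e.right

/-- The word `w`, read from bottom to top, is a tangle diagram with bottom strands `a` and
top strands `b`: consecutive slices fit together. -/
def IsTangle {ι : Type u} : List (Strand ι) → List (Slice ι) → List (Strand ι) → Prop
  | a, [], b => a = b
  | a, e :: w, b => a = e.bot ∧ IsTangle e.top w b

/-- Put vertical strands `l` on the left and `r` on the right of a tangle diagram. -/
def whisker {ι : Type u} (l r : List (Strand ι)) (w : List (Slice ι)) : List (Slice ι) :=
  w.map fun e => ⟨l ++ e.left, e.piece, e.right ++ r⟩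

/-- A diagram of an oriented link whose components are labelled by elements of `ι`:
a tangle diagram without end points. -/
structure Diagram (ι : Type u) where
  word : List (Slice ι)
  closed : IsTangle [] word []

/-- `D` contains the tangle diagram `x` in some rectangle, and `D'` is obtained from `D` by
replacing it by the tangle diagram `y`. -/
def Replaces {ι : Type u} (x y : List (Slice ι)) (D D' : Diagram ι) : Prop :=
  ∃ (p q : List (Slice ι)) (l r : List (Strand ι)),
    D.word = p ++ whisker l r x ++ q ∧ D'.word = p ++ whisker l r y ++ q

/-- The elementary planar isotopies and the Reidemeister moves, as pairs of tangle diagrams with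
the same ends. Strands may have arbitrary orientations and labels. -/
inductive Elementary {ι : Type u} : List (Slice ι) → List (Slice ι) → Prop
  /-- Planar isotopy: two pieces beside one another exchange their heights. -/
  | exchange (x y : Piece ι) (m : List (Strand ι)) :
      Elementary
        [⟨[], x, m ++ y.bot⟩, ⟨x.top ++ m, y, []⟩]
        [⟨x.bot ++ m, y, []⟩, ⟨[], x, m ++ y.top⟩]
  /-- Planar isotopy: a zigzag, formed by a minimum and a maximum on its left, is straightened. -/
  | zigzagRight (s : Strand ι) :
      Elementary [⟨[s], .cup s.flip, []⟩, ⟨[], .cap s, [s]⟩] []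
  /-- Planar isotopy: a zigzag, formed by a minimum and a maximum on its right, is straightened. -/
  | zigzagLeft (s : Strand ι) :
      Elementary [⟨[], .cup s, [s]⟩, ⟨[s], .cap s.flip, []⟩] []
  /-- Planar isotopy and second Reidemeister move: a strand `t` passes over (`o = true`) or
  under (`o = false`) a maximum. -/
  | slideCap (o : Bool) (s t : Strand ι) :
      Elementary
        [⟨[], .cross o t s, [s.flip]⟩, ⟨[s], .cross o t s.flip, []⟩, ⟨[], .cap s, [t]⟩]
        [⟨[t], .cap s, []⟩]
  /-- Planar isotopy and second Reidemeister move: a strand `t` passes under (`o = true`) or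
  over (`o = false`) a minimum. -/
  | slideCup (o : Bool) (s t : Strand ι) :
      Elementary
        [⟨[], .cup s, [t]⟩, ⟨[s], .cross o s.flip t, []⟩, ⟨[], .cross o s t, [s.flip]⟩]
        [⟨[t], .cup s, []⟩]
  /-- First Reidemeister move, with the curl on the right. -/
  | reidemeisterOneRight (o : Bool) (s : Strand ι) :
      Elementary [⟨[s], .cup s, []⟩, ⟨[], .cross o s s, [s.flip]⟩, ⟨[s], .cap s, []⟩] []
  /-- First Reidemeister move, with the curl on the left. -/
  | reidemeisterOneLeft (o : Bool) (s : Strand ι) :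
      Elementary
        [⟨[], .cup s.flip, [s]⟩, ⟨[s.flip], .cross o s s, []⟩, ⟨[], .cap s.flip, [s]⟩] []
  /-- Second Reidemeister move. -/
  | reidemeisterTwo (o : Bool) (s t : Strand ι) :
      Elementary [⟨[], .cross o s t, []⟩, ⟨[], .cross (!o) t s, []⟩] []
  /-- Third Reidemeister move. The hypothesis says that the three strands lie at three different
  levels, that is, that "over" is not cyclic on `s`, `t`, `v`. -/
  | reidemeisterThree (ost osv otv : Bool) (s t v : Strand ι) (h : ost = otv → osv = ost) :
      Elementary
        [⟨[], .cross ost s t, [v]⟩, ⟨[t], .cross osv s v, []⟩, ⟨[], .cross otv t v, [s]⟩]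
        [⟨[s], .cross otv t v, []⟩, ⟨[], .cross osv s v, [t]⟩, ⟨[v], .cross ost s t, []⟩]

/-- Two diagrams differ by a single elementary planar isotopy or Reidemeister move. -/
def Step {ι : Type u} (D D' : Diagram ι) : Prop := ∃ x y, Elementary x y ∧ Replaces x y D D'

/-- Isotopy of link diagrams: the equivalence relation generated by the elementary planar
isotopies and the Reidemeister moves. -/
def isotopy (ι : Type u) : Setoid (Diagram ι) := Relation.EqvGen.setoid Step

/-- Oriented links in the `3`-sphere with components labelled by elements of `ι`, up to ambient
isotopy respecting orientations and labels. Ordered `n`-component links are those with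
`ι = {1, …, n}` and exactly one component for each label; links without labels are those for
a one-point `ι`. -/
def Link (ι : Type u) : Type u := Quotient (isotopy ι)

/-- The link represented by a diagram. -/
def Diagram.link {ι : Type u} (D : Diagram ι) : Link ι := Quotient.mk (isotopy ι) D

/-- Two parallel strands `s`, `s'` (from bottom left to top right) cross two parallel
strands `t`, `t'` (from bottom right to top left): both `s` and `s'` pass over both `t` and `t'`
if `o = true`, and under both of them if `o = false`. -/
def doubleCrossing {ι : Type u} (o : Bool) (s s' t t' : Strand ι) : List (Slice ι) :=
  [⟨[s], .cross o s' t, [t']⟩,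
   ⟨[], .cross o s t, [s', t']⟩,
   ⟨[t, s], .cross o s' t', []⟩,
   ⟨[t], .cross o s t', [s']⟩]

/-- The local moves in which two parallel strands `s`, `s'` that pass over (or under) two other
parallel strands `t`, `t'` are made to pass under (or over) them. The strands may belong to any
components of the link; `C` restricts their orientations. -/
def DoubleMove {ι : Type u} (C : Strand ι → Strand ι → Strand ι → Strand ι → Prop)
    (L L' : Link ι) : Prop :=
  ∃ (D D' : Diagram ι) (o : Bool) (s s' t t' : Strand ι),
    D.link = L ∧ D'.link = L' ∧ C s s' t t' ∧
      Replaces (doubleCrossing o s s' t t') (doubleCrossing (!o) s s' t t') D D'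

/-- The pass-move: in each of the two pairs, the two strands have opposite orientations. -/
def PassMove {ι : Type u} : Link ι → Link ι → Prop :=
  DoubleMove fun s s' t t' => s.up ≠ s'.up ∧ t.up ≠ t'.up

/-- The `p#`-move: in one of the two pairs the two strands have opposite orientations, and in
the other pair they have the same orientation. -/
def PSharpMove {ι : Type u} : Link ι → Link ι → Prop :=
  DoubleMove fun s s' t t' =>
    (s.up = s'.up ∧ t.up ≠ t'.up) ∨ (s.up ≠ s'.up ∧ t.up = t'.up)

/-- Pass-equivalence: the equivalence relation on links generated by the pass-move. -/
def PassEquiv {ι : Type u} : Link ι → Link ι → Prop := Relation.EqvGen PassMove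

/-- The equivalence relation on links generated by the `p#`-move. -/
def PSharpEquiv {ι : Type u} : Link ι → Link ι → Prop := Relation.EqvGen PSharpMove

end LinkDiagram

namespace LinkDiagram

universe u

/-! ### Tangle diagrams and their replacement inside larger diagrams -/

section Tangle

variable {ι : Type u}

/-! Everything rests on one isotopy identity, independent of orientations. Let `s, s'` cross `t, t'`
in a double crossing. A curl in `s'` produces a double crossing of the bands `(t, s')` and `(s',
t')`; its change alters crossings of `s'` with `t` and `t'`, one crossing of `t` with `t'`, and a
self-crossing of `s'`. The last only changes the type of a curl, which the first Reidemeister move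
removes. The analogous change for `(t, s.flip)` and `(s.flip, t')`, with over and under exchanged,
cancels the effect on `t, t'`. Together the two changes are the original one
(`formalDouble_changes`, `twoMoves_of_orientation`).

It remains to compare orientations. For a pass-move exactly one of `t, t'` agrees with `s'`, and
exactly one with `s.flip`, so both auxiliary changes are `p#`-moves. For a `p#`-move, quarter turns
of the disk (`TwoMoves.turn`) bring the orientations into a position where both auxiliary changes
are pass-moves.

The isotopies are lists of elementary moves, evaluated once on formal strands and transported to all
strands by substitution. -/

@[simp] theorem Strand.up_flip (s : Strand ι) : s.flip.up = !s.up := rfl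

theorem isTangle_append {a c : List (Strand ι)} {w w' : List (Slice ι)} :
    IsTangle a (w ++ w') c ↔ ∃ b, IsTangle a w b ∧ IsTangle b w' c := by
  induction w generalizing a with
  | nil => simp [IsTangle]
  | cons e w ih => simp [IsTangle, ih, and_assoc]

theorem IsTangle.whisker {a b : List (Strand ι)} {w : List (Slice ι)} (h : IsTangle a w b)
    (l r : List (Strand ι)) : IsTangle (l ++ a ++ r) (whisker l r w) (l ++ b ++ r) := by
  induction w generalizing a with
  | nil => cases h; rfl
  | cons e w ih =>
    obtain ⟨rfl, h⟩ := h
    refine ⟨by simp [Slice.bot], ?_⟩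
    simpa [Slice.top, LinkDiagram.whisker] using ih h

theorem IsTangle.top_unique {a b c : List (Strand ι)} {w : List (Slice ι)}
    (h : IsTangle a w b) (h' : IsTangle a w c) : b = c := by
  induction w generalizing a with
  | nil => exact h.symm.trans h'
  | cons e w ih => exact ih h.2 h'.2

/-- The empty word is the identity tangle on every list of strands, so only a nonempty word
determines its ends. -/
theorem IsTangle.bot_unique {a b c d : List (Strand ι)} {w : List (Slice ι)} (hw : w ≠ [])
    (h : IsTangle a w b) (h' : IsTangle c w d) : a = c := by
  cases w with
  | nil => exact absurd rfl hw
  | cons e w => exact h.1.trans h'.1.symm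

theorem whisker_append (l r : List (Strand ι)) (w w' : List (Slice ι)) :
    whisker l r (w ++ w') = whisker l r w ++ whisker l r w' := by
  simp [whisker]

theorem whisker_whisker (l l' r r' : List (Strand ι)) (w : List (Slice ι)) :
    whisker l r (whisker l' r' w) = whisker (l ++ l') (r' ++ r) w := by
  simp [whisker, Function.comp_def]

/-- A closed diagram remains closed when a tangle in it is replaced by one with the same ends. -/
theorem IsTangle.replace {a b a₀ b₀ : List (Strand ι)} {w w' p q : List (Slice ι)}
    {l r : List (Strand ι)} (hw : w ≠ []) (h : IsTangle a w b) (h' : IsTangle a w' b)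
    (hD : IsTangle a₀ (p ++ LinkDiagram.whisker l r w ++ q) b₀) :
    IsTangle a₀ (p ++ LinkDiagram.whisker l r w' ++ q) b₀ := by
  obtain ⟨d, hD, hq⟩ := isTangle_append.1 hD
  obtain ⟨c, hp, hc⟩ := isTangle_append.1 hD
  have hne : LinkDiagram.whisker l r w ≠ [] := by simpa [LinkDiagram.whisker] using hw
  obtain rfl := (h.whisker l r).bot_unique hne hc
  obtain rfl := (h.whisker l r).top_unique hc
  exact isTangle_append.2 ⟨_, isTangle_append.2 ⟨_, hp, h'.whisker l r⟩, hq⟩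

theorem DoubleMove.symm {C : Strand ι → Strand ι → Strand ι → Strand ι → Prop} {L L' : Link ι}
    (h : DoubleMove C L L') : DoubleMove C L' L := by
  obtain ⟨D, D', o, s, s', t, t', h, h', hC, p, q, l, r, hD, hD'⟩ := h
  exact ⟨D', D, !o, s, s', t, t', h', h, hC, p, q, l, r, hD', by simpa using hD⟩

end Tangle

/-! ### Tangle diagrams with formal strands

Isotopies of tangles are checked by computation on diagrams whose strands carry natural numbers
as labels, and are then transported to arbitrary strands. -/

section Formal

instance : DecidableEq (Strand ℕ) := fun s t =>
  decidable_of_iff (s.up = t.up ∧ s.comp = t.comp) (by cases s; cases t; simp)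

/-- An injective encoding of the elementary pieces. -/
def Piece.code : Piece ℕ → ℕ × Bool × Strand ℕ × Strand ℕ
  | .cup s => (0, true, s, s)
  | .cap s => (1, true, s, s)
  | .cross o s t => (2, o, s, t)

instance : DecidableEq (Piece ℕ) := fun x y =>
  decidable_of_iff (x.code = y.code) (by cases x <;> cases y <;> simp [Piece.code])

instance : DecidableEq (Slice ℕ) := fun e e' =>
  decidable_of_iff (e.left = e'.left ∧ e.piece = e'.piece ∧ e.right = e'.right)
    (by cases e; cases e'; simp)

instance IsTangle.decidable : ∀ (a : List (Strand ℕ)) (w : List (Slice ℕ)) (b : List (Strand ℕ)),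
    Decidable (IsTangle a w b)
  | a, [], b => inferInstanceAs (Decidable (a = b))
  | a, e :: w, b =>
    have := IsTangle.decidable e.top w b
    inferInstanceAs (Decidable (a = e.bot ∧ IsTangle e.top w b))

/-- Replace the tangle `x`, with strands `l` and `r` beside it, that begins at the `i`-th slice
of `w` by `y`, provided that it occurs there and that the result is a tangle from `a` to `b`. -/
def replaceAt (a b : List (Strand ℕ)) (i : ℕ) (l r : List (Strand ℕ)) (x y w : List (Slice ℕ)) :
    Option (List (Slice ℕ)) :=
  let p := w.take i
  let q := (w.drop i).drop x.length
  if w = p ++ whisker l r x ++ q ∧ IsTangle a (p ++ whisker l r y ++ q) b then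
    some (p ++ whisker l r y ++ q)
  else none

/-- Since `replaceAt` tests both the occurrence and the result, a wrongly guessed position or side
list can only give `none`, never an invalid replacement. -/
theorem replaceAt_eq_some {a b : List (Strand ℕ)} {i : ℕ} {l r : List (Strand ℕ)}
    {x y w w' : List (Slice ℕ)} (h : replaceAt a b i l r x y w = some w') :
    IsTangle a w' b ∧ ∃ p q, w = p ++ whisker l r x ++ q ∧ w' = p ++ whisker l r y ++ q := by
  simp only [replaceAt] at h
  split_ifs at h with hc
  obtain rfl := Option.some.inj h
  exact ⟨hc.2, _, _, hc.1, rfl⟩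

/-- The types of elementary planar isotopies and Reidemeister moves used below. -/
inductive Rule
  | exchange
  | zigzag
  | slideCap (o : Bool)
  | slideCup (o : Bool)
  | curl (o : Bool)
  | two (o : Bool)
  | three (ost osv otv : Bool)

/-- The elementary move of the given type whose first (if `d = true`) or second side can begin
the word `w`, when `b` are the strands at the bottom of `w` from position `n` onwards. -/
def Rule.move (d : Bool) (n : ℕ) (w : List (Slice ℕ)) (b : List (Strand ℕ)) :
    Rule → Option {e : List (Slice ℕ) × List (Slice ℕ) // Elementary e.1 e.2}
  | .exchange =>
    match d, w with
    -- The middle strands `m` are recovered from the left of the slice containing `y`: there they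
    -- follow `n` outer strands and the top (in the other direction, the bottom) of `x`.
    | true, ⟨_, x, _⟩ :: ⟨l, y, _⟩ :: _ =>
      some ⟨(_, _), .exchange x y (l.drop (n + x.top.length))⟩
    | false, ⟨l, y, _⟩ :: ⟨_, x, _⟩ :: _ =>
      some ⟨(_, _), .exchange x y (l.drop (n + x.bot.length))⟩
    | _, _ => none
  | .zigzag =>
    match b with
    | s :: _ => some ⟨(_, _), .zigzagRight s⟩
    | _ => none
  | .slideCap o =>
    match b with
    | t :: s :: _ => some ⟨(_, _), .slideCap o s t⟩
    | _ => none
  | .slideCup o =>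
    match w, b with
    | ⟨_, .cup s, _⟩ :: _, t :: _ => some ⟨(_, _), .slideCup o s t⟩
    | _, _ => none
  | .curl o =>
    match b with
    | s :: _ => some ⟨(_, _), .reidemeisterOneRight o s⟩
    | _ => none
  | .two o =>
    match b with
    | s :: t :: _ => some ⟨(_, _), .reidemeisterTwo o s t⟩
    | _ => none
  | .three ost osv otv =>
    match b with
    | s :: t :: v :: _ =>
      if h : ost = otv → osv = ost then
        some ⟨(_, _), .reidemeisterThree ost osv otv s t v h⟩
      else none
    | _ => none

/-- An elementary move in a word: it is applied to the slices from the `slice`-th onwards and to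
the strands from position `pos` onwards, from left to right if `forward = true`. -/
structure Move where
  slice : ℕ
  pos : ℕ
  rule : Rule
  forward : Bool

/-- The strands at the bottom of a nonempty word. -/
def bottom : List (Slice ℕ) → List (Strand ℕ)
  | [] => []
  | e :: _ => e.bot

/-- Apply an elementary move to a tangle with ends `a`, `b`. -/
def Move.apply (a b : List (Strand ℕ)) (m : Move) (w : List (Slice ℕ)) :
    Option (List (Slice ℕ)) :=
  let w' := w.drop m.slice
  let c := bottom w'
  let l := c.take m.pos
  (m.rule.move m.forward m.pos w' (c.drop m.pos)).bind fun ⟨(x, y), _⟩ =>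
    -- One side of a move may be empty and then shows no strands; `x ++ y` begins with a nonempty
    -- side, and both sides have the same bottom.
    let r := c.drop (m.pos + (bottom (x ++ y)).length)
    if m.forward then replaceAt a b m.slice l r x y w else replaceAt a b m.slice l r y x w

/-- Apply a sequence of elementary moves to a tangle with ends `a`, `b`. -/
def applyMoves (a b : List (Strand ℕ)) (ms : List Move) (w : List (Slice ℕ)) :
    Option (List (Slice ℕ)) :=
  ms.foldlM (fun w m => m.apply a b w) w

/-- Two tangle diagrams differ by an elementary move in one direction or the other. -/
def Related {ι : Type u} (w w' : List (Slice ι)) : Prop :=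
  ∃ x y p q l r, (Elementary x y ∨ Elementary y x) ∧
    w = p ++ whisker l r x ++ q ∧ w' = p ++ whisker l r y ++ q

/-- Isotopy of tangle diagrams with the ends `a`, `b`. -/
inductive Isotopic (a b : List (Strand ℕ)) : List (Slice ℕ) → List (Slice ℕ) → Prop
  | refl (w : List (Slice ℕ)) (h : IsTangle a w b) : Isotopic a b w w
  | head {w w' w'' : List (Slice ℕ)} (h : IsTangle a w b) (hw : Related w w')
      (hw' : Isotopic a b w' w'') : Isotopic a b w w''

theorem Isotopic.isTangle_left {a b : List (Strand ℕ)} {w w' : List (Slice ℕ)}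
    (h : Isotopic a b w w') : IsTangle a w b := by
  cases h <;> assumption

theorem Isotopic.isTangle_right {a b : List (Strand ℕ)} {w w' : List (Slice ℕ)}
    (h : Isotopic a b w w') : IsTangle a w' b := by
  induction h <;> assumption

theorem Move.apply_eq_some {a b : List (Strand ℕ)} {m : Move} {w w' : List (Slice ℕ)}
    (h : m.apply a b w = some w') : IsTangle a w' b ∧ Related w w' := by
  obtain ⟨⟨⟨x, y⟩, he⟩, -, h⟩ := Option.bind_eq_some_iff.1 h
  dsimp only at h
  split_ifs at h
  · obtain ⟨h, p, q, hw, hw'⟩ := replaceAt_eq_some h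
    exact ⟨h, x, y, p, q, _, _, .inl he, hw, hw'⟩
  · obtain ⟨h, p, q, hw, hw'⟩ := replaceAt_eq_some h
    exact ⟨h, y, x, p, q, _, _, .inr he, hw, hw'⟩

theorem isotopic_of_applyMoves {a b : List (Strand ℕ)} {ms : List Move} {w w' : List (Slice ℕ)}
    (hw : IsTangle a w b) (h : applyMoves a b ms w = some w') : Isotopic a b w w' := by
  induction ms generalizing w with
  | nil =>
    obtain rfl := Option.some.inj h
    exact .refl _ hw
  | cons m ms ih =>
    obtain ⟨v, hv, h⟩ := Option.bind_eq_some_iff.1 h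
    obtain ⟨ht, hr⟩ := Move.apply_eq_some hv
    exact .head hw hr (ih ht h)

end Formal

/-! ### Substituting strands for formal strands -/

section Subst

variable {ι : Type u} (f : ℕ → Strand ι)

/-- Substitute the strand `f i` for the upward formal strand with label `i`. -/
def Strand.subst (s : Strand ℕ) : Strand ι := if s.up then f s.comp else (f s.comp).flip

/-- Substitute strands for the formal strands of a piece. -/
def Piece.subst : Piece ℕ → Piece ι
  | .cup s => .cup (s.subst f)
  | .cap s => .cap (s.subst f)
  | .cross o s t => .cross o (s.subst f) (t.subst f)

/-- Substitute strands for the formal strands of a slice. -/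
def Slice.subst (e : Slice ℕ) : Slice ι :=
  ⟨e.left.map (Strand.subst f), e.piece.subst f, e.right.map (Strand.subst f)⟩

@[simp] theorem Strand.subst_flip (s : Strand ℕ) : s.flip.subst f = (s.subst f).flip := by
  cases h : s.up <;> simp [Strand.subst, h, Strand.flip]

@[simp] theorem Piece.subst_bot (x : Piece ℕ) :
    (x.subst f).bot = x.bot.map (Strand.subst f) := by
  cases x <;> simp [Piece.subst, Piece.bot]

@[simp] theorem Piece.subst_top (x : Piece ℕ) :
    (x.subst f).top = x.top.map (Strand.subst f) := by
  cases x <;> simp [Piece.subst, Piece.top]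

theorem IsTangle.subst {a b : List (Strand ℕ)} {w : List (Slice ℕ)} (h : IsTangle a w b) :
    IsTangle (a.map (Strand.subst f)) (w.map (Slice.subst f)) (b.map (Strand.subst f)) := by
  induction w generalizing a with
  | nil => exact congrArg _ h
  | cons e w ih =>
    obtain ⟨rfl, h⟩ := h
    refine ⟨by simp [Slice.bot, Slice.subst], ?_⟩
    simpa [Slice.top, Slice.subst] using ih h

theorem map_subst_whisker (l r : List (Strand ℕ)) (w : List (Slice ℕ)) :
    (whisker l r w).map (Slice.subst f) =
      whisker (l.map (Strand.subst f)) (r.map (Strand.subst f)) (w.map (Slice.subst f)) := by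
  simp [whisker, Slice.subst]

/-- Elementary moves allow arbitrary orientations and labels, and substitution commutes with `flip`;
hence a computation with upward formal strands covers all cases. -/
theorem Elementary.subst {x y : List (Slice ℕ)} (h : Elementary x y) :
    Elementary (x.map (Slice.subst f)) (y.map (Slice.subst f)) := by
  cases h <;>
    simp only [List.map_cons, List.map_nil, Slice.subst, Piece.subst, List.map_append,
      Strand.subst_flip, ← Piece.subst_bot, ← Piece.subst_top]
  · exact .exchange _ _ _
  · exact .zigzagRight _
  · exact .zigzagLeft _
  · exact .slideCap _ _ _
  · exact .slideCup _ _ _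
  · exact .reidemeisterOneRight _ _
  · exact .reidemeisterOneLeft _ _
  · exact .reidemeisterTwo _ _ _
  · exact .reidemeisterThree _ _ _ _ _ _ ‹_›

theorem Related.subst {w w' : List (Slice ℕ)} (h : Related w w') :
    Related (w.map (Slice.subst f)) (w'.map (Slice.subst f)) := by
  obtain ⟨x, y, p, q, l, r, h, rfl, rfl⟩ := h
  exact ⟨_, _, p.map (Slice.subst f), q.map (Slice.subst f), _, _,
    h.imp (Elementary.subst f) (Elementary.subst f),
    by rw [List.map_append, List.map_append, map_subst_whisker],
    by rw [List.map_append, List.map_append, map_subst_whisker]⟩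

theorem Related.link_eq {w w' p q : List (Slice ι)} {l r : List (Strand ι)} (h : Related w w')
    {D D' : Diagram ι} (hD : D.word = p ++ whisker l r w ++ q)
    (hD' : D'.word = p ++ whisker l r w' ++ q) : D.link = D'.link := by
  obtain ⟨x, y, p', q', l', r', h, rfl, rfl⟩ := h
  -- A rectangle inside a rectangle is again a rectangle of the whole diagram.
  have key : ∀ z, p ++ whisker l r (p' ++ whisker l' r' z ++ q') ++ q =
      (p ++ whisker l r p') ++ whisker (l ++ l') (r' ++ r) z ++ (whisker l r q' ++ q) := by
    intro z
    simp only [whisker_append, whisker_whisker, List.append_assoc]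
  rw [key] at hD hD'
  rcases h with h | h
  · exact Quotient.sound (Relation.EqvGen.rel _ _ ⟨x, y, h, _, _, _, _, hD, hD'⟩)
  · exact (Quotient.sound (Relation.EqvGen.rel _ _ ⟨y, x, h, _, _, _, _, hD', hD⟩)).symm

/-- A place in a closed diagram into which every tangle with ends `a`, `b` fits, after
substitution of strands. -/
structure Place (a b : List (Strand ℕ)) where
  below : List (Slice ι)
  above : List (Slice ι)
  left : List (Strand ι)
  right : List (Strand ι)
  closed : ∀ w, IsTangle a w b →
    IsTangle [] (below ++ whisker left right (w.map (Slice.subst f)) ++ above) []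

variable {f} {a b : List (Strand ℕ)}

/-- The diagram with the tangle `w` in the given place. -/
def Place.fill (P : Place f a b) (w : List (Slice ℕ)) (h : IsTangle a w b) : Diagram ι :=
  ⟨_, P.closed w h⟩

/-- `Isotopic` records that every intermediate word has the ends `a`, `b`, so each of them fills the
place to a closed diagram. -/
theorem Place.link_fill_eq (P : Place f a b) {w w' : List (Slice ℕ)} (h : Isotopic a b w w') :
    (P.fill w h.isTangle_left).link = (P.fill w' h.isTangle_right).link := by
  induction h with
  | refl => rfl
  | head _ hw hw' ih => exact ((hw.subst f).link_eq rfl rfl).trans ih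

theorem Place.exists_eq_fill {D D' : Diagram ι} {x y : List (Slice ℕ)} (hx₀ : x ≠ [])
    (hx : IsTangle a x b) (hy : IsTangle a y b)
    (h : Replaces (x.map (Slice.subst f)) (y.map (Slice.subst f)) D D') :
    ∃ P : Place f a b, D = P.fill x hx ∧ D' = P.fill y hy := by
  obtain ⟨⟨_, hD⟩, ⟨_, hD'⟩⟩ := D, D'
  obtain ⟨p, q, l, r, rfl, rfl⟩ := h
  exact ⟨⟨p, q, l, r, fun w hw =>
    IsTangle.replace (by simpa using hx₀) (hx.subst f) (hw.subst f) hD⟩, rfl, rfl⟩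

theorem Place.replaces_fill (P : Place f a b) {i : ℕ} {l r : List (Strand ℕ)}
    {x y w w' : List (Slice ℕ)} (h : replaceAt a b i l r x y w = some w')
    (hw : IsTangle a w b) (hw' : IsTangle a w' b) :
    Replaces (x.map (Slice.subst f)) (y.map (Slice.subst f)) (P.fill w hw) (P.fill w' hw') := by
  obtain ⟨-, p, q, rfl, rfl⟩ := replaceAt_eq_some h
  refine ⟨P.below ++ whisker P.left P.right (p.map (Slice.subst f)),
    whisker P.left P.right (q.map (Slice.subst f)) ++ P.above,
    P.left ++ l.map (Strand.subst f), r.map (Strand.subst f) ++ P.right, ?_, ?_⟩ <;>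
  simp only [Place.fill, List.map_append, map_subst_whisker, whisker_append, whisker_whisker,
    List.append_assoc]

end Subst

/-! ### The isotopies between double crossings -/

/-- The upward formal strand with label `i`. -/
def formal (i : ℕ) : Strand ℕ := ⟨true, i⟩

/-- The bottom strands of the formal double crossing. -/
def formalBot : List (Strand ℕ) := [formal 0, formal 1, formal 2, formal 3]

/-- The top strands of the formal double crossing. -/
def formalTop : List (Strand ℕ) := [formal 2, formal 3, formal 0, formal 1]

/-- The formal double crossing. -/
def formalDouble (o : Bool) : List (Slice ℕ) :=
  doubleCrossing o (formal 0) (formal 1) (formal 2) (formal 3)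

/-- An isotopy after which strand `1` forms a curl, and the bands `(2, 1)` and `(1, 3)` form a
double crossing. -/
def movesBeforeFirst : List Move :=
  [⟨1, 0, .exchange, true⟩, ⟨1, 1, .two true, false⟩, ⟨2, 2, .two true, false⟩,
    ⟨1, 2, .curl true, false⟩, ⟨3, 1, .exchange, false⟩, ⟨4, 4, .two true, false⟩,
    ⟨5, 3, .two true, false⟩, ⟨6, 3, .slideCap false, true⟩, ⟨6, 2, .exchange, false⟩,
    ⟨3, 1, .exchange, true⟩, ⟨2, 2, .exchange, true⟩]

/-- After the first double crossing has been changed, strand `1` is pulled under the strands `2`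
and `3`, which become twisted around each other; strand `0` is bent downwards and forms a curl
such that the bands `(2, 0)` and `(0, 3)` form a double crossing. -/
def movesBetween : List Move :=
  [⟨4, 1, .exchange, true⟩, ⟨6, 2, .exchange, true⟩, ⟨5, 1, .exchange, true⟩,
    ⟨3, 3, .two true, false⟩, ⟨1, 3, .slideCup true, true⟩,
    ⟨2, 2, .three false false false, false⟩, ⟨1, 2, .exchange, false⟩, ⟨4, 2, .exchange, true⟩,
    ⟨2, 3, .curl false, true⟩, ⟨2, 1, .three false false false, false⟩,
    ⟨1, 1, .three false false false, false⟩, ⟨0, 1, .two true, true⟩,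
    ⟨3, 1, .three true false false, false⟩, ⟨2, 1, .two false, true⟩,
    ⟨0, 1, .three false false false, false⟩, ⟨4, 0, .zigzag, false⟩, ⟨5, 0, .exchange, true⟩,
    ⟨6, 1, .two true, false⟩, ⟨4, 1, .slideCup true, true⟩, ⟨6, 0, .exchange, true⟩,
    ⟨5, 1, .exchange, true⟩, ⟨6, 2, .two true, false⟩, ⟨4, 2, .slideCup true, true⟩,
    ⟨3, 1, .exchange, true⟩, ⟨2, 1, .exchange, true⟩, ⟨4, 1, .three false false false, true⟩,
    ⟨5, 1, .two true, false⟩, ⟨3, 1, .three false false true, true⟩,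
    ⟨4, 1, .three false false false, true⟩, ⟨5, 1, .three false false false, true⟩,
    ⟨5, 3, .curl false, false⟩, ⟨7, 2, .exchange, false⟩, ⟨4, 2, .exchange, true⟩,
    ⟨5, 2, .three false false false, true⟩, ⟨4, 3, .slideCup true, false⟩,
    ⟨6, 3, .two true, true⟩, ⟨8, 1, .exchange, false⟩, ⟨9, 2, .exchange, false⟩,
    ⟨7, 1, .exchange, false⟩]

/-- After the second double crossing has been changed, the twist of the strands `2` and `3` is
undone and strand `0` is pulled under them. -/
def movesAfterSecond : List Move :=
  [⟨5, 2, .exchange, false⟩, ⟨6, 1, .exchange, false⟩, ⟨9, 2, .exchange, true⟩,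
    ⟨9, 3, .slideCap false, false⟩, ⟨8, 3, .two true, true⟩, ⟨7, 4, .two true, true⟩,
    ⟨6, 1, .exchange, true⟩, ⟨4, 2, .curl true, true⟩, ⟨5, 2, .two true, true⟩,
    ⟨2, 2, .slideCup false, false⟩, ⟨4, 2, .two false, true⟩, ⟨3, 1, .exchange, false⟩,
    ⟨4, 0, .exchange, false⟩, ⟨2, 1, .slideCup false, false⟩, ⟨4, 1, .two false, true⟩,
    ⟨3, 0, .exchange, false⟩, ⟨2, 0, .zigzag, true⟩, ⟨1, 0, .exchange, false⟩]

/-- An isotopy that turns a double crossing by a quarter turn. -/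
def movesTurn (o : Bool) : List Move :=
  [⟨1, 0, .exchange, true⟩, ⟨0, 1, .zigzag, false⟩, ⟨1, 1, .exchange, true⟩,
    ⟨2, 2, .two o, false⟩, ⟨0, 2, .slideCup o, true⟩, ⟨2, 1, .exchange, true⟩,
    ⟨1, 2, .exchange, true⟩, ⟨2, 3, .two o, false⟩, ⟨0, 3, .slideCup o, true⟩,
    ⟨4, 0, .zigzag, false⟩, ⟨5, 0, .exchange, true⟩, ⟨6, 1, .two o, false⟩,
    ⟨4, 1, .slideCup o, true⟩, ⟨6, 0, .exchange, true⟩, ⟨5, 1, .exchange, true⟩,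
    ⟨6, 2, .two o, false⟩, ⟨4, 2, .slideCup o, true⟩, ⟨3, 1, .exchange, true⟩,
    ⟨2, 2, .exchange, true⟩, ⟨1, 3, .exchange, true⟩, ⟨4, 1, .exchange, true⟩,
    ⟨5, 1, .exchange, true⟩]

theorem formalDouble_isTangle (o : Bool) : IsTangle formalBot (formalDouble o) formalTop := by
  cases o <;> decide

/-- The change of a double crossing is, up to isotopy, the change of two other ones. -/
theorem formalDouble_changes :
    ((((applyMoves formalBot formalTop movesBeforeFirst (formalDouble true)).bind
      (replaceAt formalBot formalTop 3 [formal 0] [(formal 1).flip]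
        (doubleCrossing true (formal 2) (formal 1) (formal 1) (formal 3))
        (doubleCrossing false (formal 2) (formal 1) (formal 1) (formal 3)))).bind
      (applyMoves formalBot formalTop movesBetween)).bind
      (replaceAt formalBot formalTop 6 [formal 0] [formal 0, formal 0, formal 1]
        (doubleCrossing false (formal 2) (formal 0).flip (formal 0).flip (formal 3))
        (doubleCrossing true (formal 2) (formal 0).flip (formal 0).flip (formal 3)))).bind
      (applyMoves formalBot formalTop movesAfterSecond) = some (formalDouble false) := by
  -- A result `some _` forces every move and both crossing changes in the chain to succeed.
  decide +kernel

/-- A double crossing, turned by a quarter turn, can be changed in place. -/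
theorem formalDouble_turn (o : Bool) :
    (applyMoves formalBot formalTop (movesTurn o) (formalDouble o)).bind
      (replaceAt formalBot formalTop 2 [formal 0, formal 1] [formal 0, formal 1]
        (doubleCrossing (!o) (formal 2) (formal 3) (formal 1).flip (formal 0).flip)
        (doubleCrossing o (formal 2) (formal 3) (formal 1).flip (formal 0).flip)) =
      applyMoves formalBot formalTop (movesTurn !o) (formalDouble !o) := by
  cases o <;> decide +kernel

/-- Excludes that the equation `formalDouble_turn` holds merely because both sides are `none`. -/
theorem formalDouble_turn_isSome (o : Bool) :
    (applyMoves formalBot formalTop (movesTurn o) (formalDouble o)).isSome := by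
  cases o <;> decide +kernel

/-! ### Orientations, and the exchange of one move for two of the other kind -/

section Change

variable {ι : Type u} {C : Strand ι → Strand ι → Strand ι → Strand ι → Prop}
  {s s' t t' : Strand ι}

/-- The change of a double crossing of the strands `s`, `s'` with `t`, `t'` can be achieved by two
double moves with orientations restricted by `C`. -/
def TwoMoves (C : Strand ι → Strand ι → Strand ι → Strand ι → Prop) (s s' t t' : Strand ι) :
    Prop :=
  ∀ (o : Bool) (D D' : Diagram ι),
    Replaces (doubleCrossing o s s' t t') (doubleCrossing (!o) s s' t t') D D' →
      ∃ M, DoubleMove C D.link M ∧ DoubleMove C M D'.link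

/-- Substitute `s`, `s'`, `t`, `t'` for the formal strands. -/
def assign (s s' t t' : Strand ι) : ℕ → Strand ι
  | 0 => s
  | 1 => s'
  | 2 => t
  | _ => t'

theorem exists_place {o : Bool} {D D' : Diagram ι}
    (h : Replaces (doubleCrossing o s s' t t') (doubleCrossing (!o) s s' t t') D D') :
    ∃ P : Place (assign s s' t t') formalBot formalTop,
      D = P.fill _ (formalDouble_isTangle o) ∧ D' = P.fill _ (formalDouble_isTangle !o) :=
  Place.exists_eq_fill (List.cons_ne_nil _ _) _ _ h

/-- The hypotheses are the orientation conditions for the two auxiliary changes in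
`formalDouble_changes`. A strand may occur in both bands, as the strands of a double move may belong
to any components. -/
theorem twoMoves_of_orientation (h₁ : C t s' s' t') (h₂ : C t s.flip s.flip t') :
    TwoMoves C s s' t t' := by
  have key : ∀ D D' : Diagram ι,
      Replaces (doubleCrossing true s s' t t') (doubleCrossing false s s' t t') D D' →
        ∃ M, DoubleMove C D.link M ∧ DoubleMove C M D'.link := by
    intro D D' h
    obtain ⟨P, rfl, rfl⟩ := exists_place h
    obtain ⟨w₄, h, h₅⟩ := Option.bind_eq_some_iff.1 formalDouble_changes
    obtain ⟨w₃, h, h₄⟩ := Option.bind_eq_some_iff.1 h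
    obtain ⟨w₂, h, h₃⟩ := Option.bind_eq_some_iff.1 h
    obtain ⟨w₁, h, h₂'⟩ := Option.bind_eq_some_iff.1 h
    have i₁ := isotopic_of_applyMoves (formalDouble_isTangle true) h
    have i₂ := isotopic_of_applyMoves (replaceAt_eq_some h₂').1 h₃
    have i₃ := isotopic_of_applyMoves (replaceAt_eq_some h₄).1 h₅
    refine ⟨(P.fill w₂ i₂.isTangle_left).link,
      ⟨P.fill w₁ i₁.isTangle_right, P.fill w₂ i₂.isTangle_left, true, t, s', s', t',
        (P.link_fill_eq i₁).symm, rfl, h₁, P.replaces_fill h₂' _ _⟩,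
      ⟨P.fill w₃ i₂.isTangle_right, P.fill w₄ i₃.isTangle_left, false, t, s.flip, s.flip, t',
        (P.link_fill_eq i₂).symm, P.link_fill_eq i₃, h₂, P.replaces_fill h₄ _ _⟩⟩
  rintro (_ | _) D D' h
  -- For `o = false` the same chain is read backwards, double moves being symmetric.
  · obtain ⟨M, h, h'⟩ := key D' D (by
      obtain ⟨p, q, l, r, hD, hD'⟩ := h
      exact ⟨p, q, l, r, hD', hD⟩)
    exact ⟨M, h'.symm, h.symm⟩
  · exact key D D' h

theorem TwoMoves.turn (h : TwoMoves C t t' s'.flip s.flip) : TwoMoves C s s' t t' := by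
  intro o D D' hD
  obtain ⟨P, rfl, rfl⟩ := exists_place hD
  obtain ⟨w, hw⟩ := Option.isSome_iff_exists.1 (formalDouble_turn_isSome o)
  obtain ⟨w', hw'⟩ := Option.isSome_iff_exists.1 (formalDouble_turn_isSome !o)
  have hr := formalDouble_turn o
  rw [hw, hw', Option.bind_some] at hr
  have i := isotopic_of_applyMoves (formalDouble_isTangle o) hw
  have i' := isotopic_of_applyMoves (formalDouble_isTangle !o) hw'
  -- After the quarter turn `t, t'` is the first pair, so over and under exchange roles: `o` becomes
  -- `!o`.
  obtain ⟨M, h, h'⟩ := h (!o) (P.fill w i.isTangle_right) (P.fill w' i'.isTangle_right) (by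
    rw [Bool.not_not]
    exact P.replaces_fill hr _ _)
  exact ⟨M, P.link_fill_eq i ▸ h, P.link_fill_eq i' ▸ h'⟩

theorem DoubleMove.exists_two {C' : Strand ι → Strand ι → Strand ι → Strand ι → Prop}
    (hC : ∀ s s' t t', C' s s' t t' → TwoMoves C s s' t t') {L L' : Link ι}
    (h : DoubleMove C' L L') : ∃ M, DoubleMove C L M ∧ DoubleMove C M L' := by
  obtain ⟨D, D', o, s, s', t, t', rfl, rfl, h, hD⟩ := h
  exact hC s s' t t' h o D D' hD

/-- If `s'` is opposite to `t`, it is opposite to `t'` too, and so is `s.flip`, which has the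
direction of `s'`; both auxiliary changes are then pass-moves. -/
theorem twoMoves_pass (h : s.up ≠ s'.up) (h' : t.up = t'.up) :
    TwoMoves (fun s s' t t' => s.up ≠ s'.up ∧ t.up ≠ t'.up) s s' t t' := by
  have key : ∀ {s s' t t' : Strand ι}, s.up ≠ s'.up → t.up = t'.up → s'.up ≠ t.up →
      TwoMoves (fun s s' t t' => s.up ≠ s'.up ∧ t.up ≠ t'.up) s s' t t' := by
    intro s s' t t' h₁ h₂ h₃
    apply twoMoves_of_orientation
    · exact ⟨fun h => h₃ h.symm, fun h => h₃ (h.trans h₂.symm)⟩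
    · have h₄ : s.up = t.up := by
        cases hs : s.up <;> cases hs' : s'.up <;> cases ht : t.up <;> simp_all
      simp [h₄, ← h₂]
  by_cases h₃ : s'.up = t.up
  -- A half turn puts `s.flip` in place of `s'`, with the same direction, and `t'.flip` in place of
  -- `t`, with the opposite one.
  · refine .turn (.turn (key ?_ ?_ ?_)) <;> simp_all [eq_comm]
  · exact key h h' h₃

theorem PSharpMove.exists_passMove {L L' : Link ι} (h : PSharpMove L L') :
    ∃ M, PassMove L M ∧ PassMove M L' := by
  refine DoubleMove.exists_two (fun s s' t t' h => ?_) h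
  rcases h with ⟨h₁, h₂⟩ | ⟨h₁, h₂⟩
  -- A quarter turn makes the antiparallel pair the first one.
  · exact .turn (twoMoves_pass h₂ (by simp [h₁]))
  · exact twoMoves_pass h₁ h₂

theorem PassMove.exists_pSharpMove {L L' : Link ι} (h : PassMove L L') :
    ∃ M, PSharpMove L M ∧ PSharpMove M L' := by
  refine DoubleMove.exists_two (fun s s' t t' h => ?_) h
  -- As `t` and `t'` are opposite, any strand agrees with exactly one of them; this applies to `s'`
  -- and to `s.flip`.
  apply twoMoves_of_orientation <;>
    cases hs : s.up <;> cases hs' : s'.up <;> cases ht : t.up <;> cases ht' : t'.up <;>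
    simp_all

end Change

/-- The equivalence relation generated by `r` is contained in the one generated by `r'` if every
`r`-step is a composition of two `r'`-steps. -/
theorem eqvGen_of_two_steps {α : Type*} {r r' : α → α → Prop}
    (h : ∀ x y, r x y → ∃ z, r' x z ∧ r' z y) {x y : α} (hxy : Relation.EqvGen r x y) :
    Relation.EqvGen r' x y := by
  induction hxy with
  | rel x y hxy =>
    obtain ⟨z, hxz, hzy⟩ := h x y hxy
    exact .trans _ _ _ (.rel _ _ hxz) (.rel _ _ hzy)
  | refl x => exact .refl x
  | symm _ _ _ ih => exact .symm _ _ ih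
  | trans _ _ _ _ _ ih ih' => exact .trans _ _ _ ih ih'

end LinkDiagram

theorem mainTheorem11 {ι : Type*} :
    (∀ L L' : LinkDiagram.Link ι,
      LinkDiagram.PSharpEquiv L L' ↔ LinkDiagram.PassEquiv L L') ∧
    (∀ L L' : LinkDiagram.Link ι, LinkDiagram.PSharpMove L L' →
      ∃ M : LinkDiagram.Link ι, LinkDiagram.PassMove L M ∧ LinkDiagram.PassMove M L') ∧
    (∀ L L' : LinkDiagram.Link ι, LinkDiagram.PassMove L L' →
      ∃ M : LinkDiagram.Link ι, LinkDiagram.PSharpMove L M ∧ LinkDiagram.PSharpMove M L') := by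
  have h₁ := fun L L' => LinkDiagram.PSharpMove.exists_passMove (ι := ι) (L := L) (L' := L')
  have h₂ := fun L L' => LinkDiagram.PassMove.exists_pSharpMove (ι := ι) (L := L) (L' := L')
  exact ⟨fun L L' => ⟨LinkDiagram.eqvGen_of_two_steps h₁, LinkDiagram.eqvGen_of_two_steps h₂⟩,
    h₁, h₂⟩
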